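/- Let $A=\mathbb F_2[x,y]/(y^2+y=x^3+x+1)$, with the degree function $\deg=-v_\infty$, so that $\deg x=2$, $\deg y=3$. Let $A\{\tau\}$ be the ring of twisted polynomials ($\tau a=a^2\tau$), and let $\rho\colon A\to A\{\tau\}$, $a\mapsto\rho_a$, be the rank-one Drinfeld module given by $$\rho_x=x+(x^2+x)\tau+\tau^2,\qquad \rho_y=y+(y^2+y)\tau+x(y^2+y)\tau^2+\tau^3 .$$ For $f=\sum_k f_k\tau^k\in A\{\tau\}$ and a power series $g$ put $f(g)=\sum_k f_k\,g^{2^k}$. Let $D_k=\prod_{a\in A,\ \deg a=k}a$, and let $L$ be any field containing $A$ (for instance $L=\mathbb C_\infty$, the completion of an algebraic closure of the completion of $\mathrm{Frac}(A)$ at $\infty$). There is a unique power series $e(z)=\sum_{i\ge0}a_iz^{2^i}\in L[[z]]$ with $a_0=1$ and $e(az)=\rho_a(e(z))$ for all $a\in A$ (the exponential of $\rho$), and a unique power series $\log(z)\in L[[z]]$ with zero constant term and $e(\log(z))=z$. They have the form $$e(z)=\sum_{i\ge0}\frac{z^{2^i}}{d_i},\qquad \log(z)=\sum_{i\ge0}\frac{z^{2^i}}{\ell_i}$$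 with all $d_i,\ell_i\in L$ nonzero, and the following hold. 1. $d_2=D_2$. 2. For every $k\ge2$, $d_{k-1}+D_k\neq0$ and $$d_k=\frac{D_kd_{k-1}}{d_{k-1}+D_k}\left(1+D_k+D_{k-1}^2+\cdots+D_2^{2^{k-2}}\right).$$ 3. For every $k\ge2$, $(d_k+D_k^2)\,D_{k-1}D_{k-2}\cdots D_2\neq0$ and $$\ell_k=\frac{D_kd_k}{(d_k+D_k^2)\,(D_{k-1}D_{k-2}\cdots D_2)}$$ (for $k=2$ the product $D_{k-1}\cdots D_2$ is empty, equal to $1$). -/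

import Mathlib

noncomputable section

namespace DrinfeldExample

open Polynomial

/-- The curve `y² + y = x³ + x + 1` over `𝔽₂`. -/
def curve : WeierstrassCurve.Affine (ZMod 2) := ⟨0, 0, 1, 1, 1⟩

/-- `A = 𝔽₂[x, y] / (y² + y = x³ + x + 1)`. -/
abbrev A : Type := curve.CoordinateRing

/-- The class of `x` in `A`. -/
def x : A := WeierstrassCurve.Affine.CoordinateRing.mk curve (C X)

/-- The class of `y` in `A`. -/
def y : A := WeierstrassCurve.Affine.CoordinateRing.mk curve X

theorem two_eq_zero : (2 : A) = 0 := by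
  have h : algebraMap (ZMod 2) A 2 = 2 := map_ofNat _ 2
  rw [← h, show (2 : ZMod 2) = 0 from rfl, map_zero]

instance : CharP A 2 :=
  CharTwo.of_one_ne_zero_of_two_eq_zero one_ne_zero two_eq_zero

theorem curve_eq : y ^ 2 + y = x ^ 3 + x + 1 := by
  have h : WeierstrassCurve.Affine.CoordinateRing.mk curve curve.polynomial = 0 :=
    AdjoinRoot.mk_self
  simp only [WeierstrassCurve.Affine.polynomial, curve, map_add, map_pow, map_zero, map_one, zero_mul, zero_add,
    one_mul, add_zero] at h
  exact sub_eq_zero.mp h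

/-! ### The degree and the products `D k` -/

/-- The degree `deg a = -v_∞(a)`. The place `∞` is the only place of the function field above the
place `1/x` of `𝔽₂(x)` and is totally ramified over it, so `-v_∞(a)` is the degree in `x` of the
norm of `a` from `A` to `𝔽₂[x]`; `deg 0 = ⊥`. The lemmas that follow identify it with the degree
determined by `deg x = 2` and `deg y = 3`. -/
def deg (a : A) : WithBot ℕ := (Algebra.norm (ZMod 2)[X] a).degree

theorem deg_smul_basis (p q : (ZMod 2)[X]) :
    deg (p • (1 : A) + q • y) = max (2 • p.degree) (2 • q.degree + 3) :=
  WeierstrassCurve.Affine.CoordinateRing.degree_norm_smul_basis p q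

theorem deg_mul (a b : A) : deg (a * b) = deg a + deg b := by
  simp [deg]

theorem deg_add_le (a b : A) : deg (a + b) ≤ max (deg a) (deg b) := by
  obtain ⟨p, q, rfl⟩ := WeierstrassCurve.Affine.CoordinateRing.exists_smul_basis_eq a
  obtain ⟨r, s, rfl⟩ := WeierstrassCurve.Affine.CoordinateRing.exists_smul_basis_eq b
  have h : p • (1 : A) + q • y + (r • (1 : A) + s • y) = (p + r) • (1 : A) + (q + s) • y := by
    rw [add_smul, add_smul]
    abel
  change deg (p • (1 : A) + q • y + (r • (1 : A) + s • y)) ≤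
    max (deg (p • (1 : A) + q • y)) (deg (r • (1 : A) + s • y))
  rw [h, deg_smul_basis, deg_smul_basis, deg_smul_basis]
  rcases le_max_iff.mp (degree_add_le p r) with h₁ | h₁ <;>
  rcases le_max_iff.mp (degree_add_le q s) with h₂ | h₂ <;>
  refine max_le ((nsmul_le_nsmul_right h₁ 2).trans ?_)
    ((add_le_add_left (nsmul_le_nsmul_right h₂ 2) 3).trans ?_) <;>
  simp

theorem x_eq_smul : x = (X : (ZMod 2)[X]) • (1 : A) := by
  rw [WeierstrassCurve.Affine.CoordinateRing.smul, mul_one]; rfl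

theorem deg_x : deg x = 2 := by
  have h := deg_smul_basis X 0
  rw [zero_smul, add_zero, ← x_eq_smul] at h
  rw [h]
  simp

theorem deg_y : deg y = 3 := by
  have h := deg_smul_basis 0 1
  rw [zero_smul, zero_add, one_smul] at h
  rw [h]
  simp

theorem finite_deg_eq (k : ℕ) : {a : A | deg a = k}.Finite := by
  have hfin : (Polynomial.degreeLT (ZMod 2) (k + 1) : Set (ZMod 2)[X]).Finite := by
    have : Finite (Polynomial.degreeLT (ZMod 2) (k + 1)) :=
      Finite.of_equiv _ (Polynomial.degreeLTEquiv (ZMod 2) (k + 1)).symm.toEquiv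
    exact Set.toFinite _
  refine ((hfin.prod hfin).image fun r : (ZMod 2)[X] × (ZMod 2)[X] =>
    r.1 • (1 : A) + r.2 • y).subset ?_
  intro a ha
  obtain ⟨p, q, rfl⟩ := WeierstrassCurve.Affine.CoordinateRing.exists_smul_basis_eq a
  have h : max (2 • p.degree) (2 • q.degree + 3) = (k : WithBot ℕ) :=
    (deg_smul_basis p q).symm.trans ha
  have hp : 2 • p.degree ≤ (k : WithBot ℕ) := h ▸ le_max_left _ _
  have hq : 2 • q.degree + 3 ≤ (k : WithBot ℕ) := h ▸ le_max_right _ _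
  refine ⟨(p, q), ⟨?_, ?_⟩, rfl⟩
  · simp only [SetLike.mem_coe, Polynomial.mem_degreeLT]
    by_cases h0 : p = 0
    · simp [h0]
    · rw [Polynomial.degree_eq_natDegree h0] at hp ⊢
      rw [two_nsmul] at hp
      norm_cast at hp ⊢
      omega
  · simp only [SetLike.mem_coe, Polynomial.mem_degreeLT]
    by_cases h0 : q = 0
    · simp [h0]
    · rw [Polynomial.degree_eq_natDegree h0] at hq ⊢
      rw [two_nsmul] at hq
      norm_cast at hq ⊢
      omega

/-- `D k` is the product of all elements of `A` of degree `k`. -/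
def D (k : ℕ) : A := ∏ a ∈ (finite_deg_eq k).toFinset, a

/-! ### The Drinfeld module -/

/-- The action of `ℕ` on `A` by iterates of the Frobenius `a ↦ a ^ 2`. With it,
`SkewPolynomial A` is the twisted polynomial ring `A{τ}`, in which `τ a = a² τ`. -/
instance frobeniusAction : MulSemiringAction (Multiplicative ℕ) A where
  smul n a := a ^ 2 ^ (Multiplicative.toAdd n)
  one_smul a := by
    change a ^ 2 ^ 0 = a
    simp
  mul_smul m n a := by
    change a ^ 2 ^ (Multiplicative.toAdd m + Multiplicative.toAdd n)
      = (a ^ 2 ^ Multiplicative.toAdd n) ^ 2 ^ Multiplicative.toAdd m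
    rw [← pow_mul, pow_add, mul_comm]
  smul_zero n := by
    change (0 : A) ^ 2 ^ Multiplicative.toAdd n = 0
    simp
  smul_add n a b := add_pow_char_pow a b 2 (Multiplicative.toAdd n)
  smul_one n := one_pow _
  smul_mul n a b := mul_pow a b _

theorem smul_eq_pow (n : ℕ) (a : A) : Multiplicative.ofAdd n • a = a ^ 2 ^ n := rfl

/-- `ρ_x = x + (x² + x) τ + τ²`. -/
def rhoX : SkewPolynomial A :=
  SkewPolynomial.monomial 0 x + SkewPolynomial.monomial 1 (x ^ 2 + x) +
    SkewPolynomial.monomial 2 1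

/-- `ρ_y = y + (y² + y) τ + x (y² + y) τ² + τ³`. -/
def rhoY : SkewPolynomial A :=
  SkewPolynomial.monomial 0 y + SkewPolynomial.monomial 1 (y ^ 2 + y) +
    SkewPolynomial.monomial 2 (x * (y ^ 2 + y)) + SkewPolynomial.monomial 3 1

theorem monomial_mul (n m : ℕ) (r s : A) :
    SkewPolynomial.monomial n r * SkewPolynomial.monomial m s
      = SkewPolynomial.monomial (n + m) (r * s ^ 2 ^ n) := by
  rw [SkewPolynomial.monomial_mul_monomial, SkewPolynomial.φ_iterate_apply, smul_eq_pow]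

theorem coeff_add' (p q : SkewPolynomial A) (n : ℕ) :
    (p + q).coeff n = p.coeff n + q.coeff n := by
  simp [SkewPolynomial.coeff]

theorem rhoX_comm_rhoY : Commute rhoX rhoY := by
  have h2 := two_eq_zero
  have hy : y ^ 2 = x ^ 3 + x + 1 - y := by rw [← curve_eq]; ring
  change rhoX * rhoY = rhoY * rhoX
  simp only [rhoX, rhoY, mul_add, add_mul, monomial_mul]
  refine SkewMonoidAlgebra.ext fun n => ?_
  induction n using Multiplicative.rec with | ofAdd n => ?_
  change SkewPolynomial.coeff _ n = SkewPolynomial.coeff _ n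
  simp only [coeff_add', SkewPolynomial.coeff_monomial]
  rcases n with _ | _ | _ | _ | _ | _ | n <;> simp <;> grind

theorem rho_curve_eq : rhoY ^ 2 + rhoY = rhoX ^ 3 + rhoX + 1 := by
  have h2 := two_eq_zero
  have hy : y ^ 2 = x ^ 3 + x + 1 - y := by rw [← curve_eq]; ring
  have h1 : (1 : SkewPolynomial A) = SkewPolynomial.monomial 0 1 := rfl
  rw [pow_two, pow_succ, pow_two, h1]
  simp only [rhoX, rhoY, mul_add, add_mul, monomial_mul]
  refine SkewMonoidAlgebra.ext fun n => ?_
  induction n using Multiplicative.rec with | ofAdd n => ?_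
  change SkewPolynomial.coeff _ n = SkewPolynomial.coeff _ n
  simp only [coeff_add', SkewPolynomial.coeff_monomial]
  rcases n with _ | _ | _ | _ | _ | _ | _ | n <;> simp <;> grind

/-- The embedding of the scalars `𝔽₂` in `A{τ}`. -/
def scalarHom : ZMod 2 →+* SkewPolynomial A :=
  SkewPolynomial.CRingHom.comp (algebraMap (ZMod 2) A)

theorem scalarHom_commute (c : ZMod 2) (p : SkewPolynomial A) : Commute (scalarHom c) p := by
  fin_cases c
  · change Commute (scalarHom 0) p
    simp
  · change Commute (scalarHom 1) p
    simp

/-- The homomorphism `𝔽₂[x] → A{τ}` that sends `x` to `ρ_x`. -/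
def rhoPoly : (ZMod 2)[X] →+* SkewPolynomial A :=
  eval₂RingHom' scalarHom rhoX fun c => scalarHom_commute c rhoX

theorem rhoPoly_commute (p : (ZMod 2)[X]) : Commute (rhoPoly p) rhoY := by
  induction p using Polynomial.induction_on' with
  | add p q hp hq => rw [map_add]; exact hp.add_left hq
  | monomial n c =>
    have h : rhoPoly (monomial n c) = scalarHom c * rhoX ^ n := eval₂_monomial _ _
    rw [h]
    exact (scalarHom_commute c rhoY).mul_left (rhoX_comm_rhoY.pow_left n)

/-- The homomorphism `𝔽₂[x][y] → A{τ}` that sends `x` to `ρ_x` and `y` to `ρ_y`. -/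
def rhoPoly₂ : (ZMod 2)[X][X] →+* SkewPolynomial A :=
  eval₂RingHom' rhoPoly rhoY rhoPoly_commute

theorem rhoPoly_X : rhoPoly X = rhoX := eval₂_X _ _

theorem rhoPoly₂_C (p : (ZMod 2)[X]) : rhoPoly₂ (C p) = rhoPoly p := eval₂_C _ _

theorem rhoPoly₂_X : rhoPoly₂ X = rhoY := eval₂_X _ _

theorem rhoPoly₂_polynomial : rhoPoly₂ curve.polynomial = 0 := by
  have h : curve.polynomial = X ^ 2 + X - (C X ^ 3 + C X + 1) := by
    simp [WeierstrassCurve.Affine.polynomial, curve]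
  refine (congrArg rhoPoly₂ h).trans ?_
  rw [map_sub, sub_eq_zero]
  simp only [map_add, map_pow, map_one, rhoPoly₂_C, rhoPoly₂_X, rhoPoly_X]
  exact rho_curve_eq

/-- The Drinfeld module `ρ : A → A{τ}`, `a ↦ ρ_a`, the ring homomorphism with the given values at
`x` and `y`. -/
def rho : A →+* SkewPolynomial A :=
  Ideal.Quotient.lift (Ideal.span {curve.polynomial}) rhoPoly₂ fun p hp => by
    have h : Ideal.span {curve.polynomial} ≤ RingHom.ker rhoPoly₂ := by
      rw [Ideal.span_singleton_le_iff_mem]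
      exact rhoPoly₂_polynomial
    exact h hp

theorem rho_x : rho x = rhoX := (rhoPoly₂_C X).trans rhoPoly_X

theorem rho_y : rho y = rhoY := rhoPoly₂_X

/-! ### The exponential and the logarithm -/

section Series

open PowerSeries

variable {L : Type*} [Field L]

/-- The power series `∑ i, c i * z ^ (2 ^ i)`. -/
def linearSeries (c : ℕ → L) : L⟦X⟧ :=
  PowerSeries.mk fun n => if n = 2 ^ Nat.log 2 n then c (Nat.log 2 n) else 0

variable [Algebra A L]

/-- The twisted polynomial `f = ∑ f_k τ ^ k` applied to a power series `g`:
`f(g) = ∑ f_k * g ^ (2 ^ k)`. -/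
def twistedApply (f : SkewPolynomial A) (g : L⟦X⟧) : L⟦X⟧ :=
  f.sum fun k c => PowerSeries.C (algebraMap A L c) * g ^ 2 ^ k

/-- `e` is the normalized exponential of `ρ`: it has the form `∑ a_i z ^ (2 ^ i)` with `a_0 = 1`,
and `e(a z) = ρ_a(e(z))` for all `a ∈ A`. -/
structure IsExponential (e : L⟦X⟧) : Prop where
  linear : ∃ a : ℕ → L, a 0 = 1 ∧ e = linearSeries a
  functional_eq : ∀ a : A, PowerSeries.rescale (algebraMap A L a) e = twistedApply (rho a) e

/-- `l` is the formal inverse of `e` at the origin: `l(0) = 0` and `e(l(z)) = z`. -/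
structure IsLogarithm (e l : L⟦X⟧) : Prop where
  constantCoeff_eq_zero : PowerSeries.constantCoeff l = 0
  subst_eq_X : PowerSeries.subst l e = PowerSeries.X

end Series

end DrinfeldExample
end

/-!
In the ring of twisted power series the exponential `e` has an inverse `log`, and the functional
equation becomes `ρ_a = e * a * log`. Hence the coefficient of `τ ^ k` in `ρ_a` is `P_k(a)`, where
`P_k` is an additive polynomial of degree at most `2 ^ k` whose coefficients of `X ^ 2 ^ k`,
`X ^ 2 ^ (k - 1)` and `X` are `1 / d_k`, `1 / d_{k-1}` and `1 / ℓ_k`. As `ρ_a` is monic of degree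
`deg a` in `τ`, `P_k` vanishes on the elements of degree less than `k` and is `1` on those of
degree `k`.

The polynomial `E_k = ∏_{deg c < k} (X - c)` is additive, takes the value `D_k` on the elements of
degree `k`, and for `k ≥ 2` has degree `2 ^ (k - 1)`, because no element of `A` has degree `1`.
Therefore `P_k = (1 / d_k) E_k ^ 2 + μ E_k` for some constant `μ`. The formulas for `d_k` and `ℓ_k`
result from eliminating `μ` between the value at an element of degree `k` and the coefficients of
`X ^ 2 ^ (k - 1)` and `X`; the coefficients of `E_k` that enter are read off from
`E_{k+1} = E_k ^ 2 + D_k E_k`. Comparing degrees shows that nothing one divides by is zero.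
-/

noncomputable section

namespace DrinfeldExample

/-! ### Twisted power series -/

/-- The skew power series `∑ f_i τ ^ i` over `R`, multiplied by means of `τ c = φ c τ`; they
complete the skew polynomials, and for the Frobenius `φ` they contain the operators
`z ↦ ∑ f_i z ^ (p ^ i)`. -/
@[ext] structure SkewPowerSeries {R : Type*} [Semiring R] (φ : R →+* R) where
  /-- The sequence of coefficients. -/
  coeff : ℕ → R

namespace SkewPowerSeries

open Finset

section Semiring

variable {R : Type*} [Semiring R] {φ : R →+* R}

/-- The skew monomial `c τ ^ i`. -/
def monomial (i : ℕ) (c : R) : SkewPowerSeries φ := ⟨Pi.single i c⟩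

instance : Zero (SkewPowerSeries φ) := ⟨⟨0⟩⟩

instance : One (SkewPowerSeries φ) := ⟨monomial 0 1⟩

instance : Add (SkewPowerSeries φ) := ⟨fun f g => ⟨f.coeff + g.coeff⟩⟩

instance : Mul (SkewPowerSeries φ) :=
  ⟨fun f g => ⟨fun n => ∑ p ∈ antidiagonal n, f.coeff p.1 * (φ ^ p.1) (g.coeff p.2)⟩⟩

theorem ext_coeff {f g : SkewPowerSeries φ} (h : ∀ n, f.coeff n = g.coeff n) : f = g :=
  SkewPowerSeries.ext (funext h)

@[simp] theorem coeff_zero (n : ℕ) : (0 : SkewPowerSeries φ).coeff n = 0 := rfl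

@[simp] theorem coeff_add (f g : SkewPowerSeries φ) (n : ℕ) :
    (f + g).coeff n = f.coeff n + g.coeff n := rfl

theorem coeff_mul (f g : SkewPowerSeries φ) (n : ℕ) :
    (f * g).coeff n = ∑ p ∈ antidiagonal n, f.coeff p.1 * (φ ^ p.1) (g.coeff p.2) := rfl

theorem coeff_monomial (i : ℕ) (c : R) (n : ℕ) :
    (monomial i c : SkewPowerSeries φ).coeff n = if n = i then c else 0 :=
  Pi.single_apply ..

theorem coeff_one (n : ℕ) : (1 : SkewPowerSeries φ).coeff n = if n = 0 then 1 else 0 :=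
  coeff_monomial ..

theorem coeff_monomial_mul (i : ℕ) (c : R) (g : SkewPowerSeries φ) (n : ℕ) :
    (monomial i c * g).coeff n = if i ≤ n then c * (φ ^ i) (g.coeff (n - i)) else 0 := by
  rw [coeff_mul, Nat.sum_antidiagonal_eq_sum_range_succ_mk]
  simp only [coeff_monomial, ite_mul, zero_mul, sum_ite_eq', mem_range, Nat.lt_succ_iff]

theorem coeff_mul_monomial_zero (f : SkewPowerSeries φ) (c : R) (n : ℕ) :
    (f * monomial 0 c).coeff n = f.coeff n * (φ ^ n) c := by
  rw [coeff_mul, sum_eq_single (n, 0)]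
  · simp [coeff_monomial]
  · rintro ⟨i, j⟩ hij hne
    have hj : j ≠ 0 := by
      rintro rfl
      exact hne (by simpa using hij)
    simp [coeff_monomial, hj]
  · simp

instance : Semiring (SkewPowerSeries φ) where
  add_assoc _ _ _ := ext_coeff fun _ => add_assoc ..
  zero_add _ := ext_coeff fun _ => zero_add _
  add_zero _ := ext_coeff fun _ => add_zero _
  add_comm _ _ := ext_coeff fun _ => add_comm ..
  nsmul := nsmulRec
  zero_mul _ := ext_coeff fun _ => by simp [coeff_mul]
  mul_zero _ := ext_coeff fun _ => by simp [coeff_mul]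
  one_mul _ := ext_coeff fun _ => by
    rw [show (1 : SkewPowerSeries φ) = monomial 0 1 from rfl, coeff_monomial_mul]
    simp
  mul_one _ := ext_coeff fun _ => by
    rw [show (1 : SkewPowerSeries φ) = monomial 0 1 from rfl, coeff_mul_monomial_zero]
    simp
  left_distrib _ _ _ := ext_coeff fun _ => by
    simp only [coeff_mul, coeff_add, map_add, mul_add, sum_add_distrib]
  right_distrib _ _ _ := ext_coeff fun _ => by
    simp only [coeff_mul, coeff_add, add_mul, sum_add_distrib]
  mul_assoc f g h := ext_coeff fun n => by
    have pow_add_apply (i j : ℕ) (c : R) : (φ ^ (i + j)) c = (φ ^ i) ((φ ^ j) c) := by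
      rw [pow_add, RingHom.mul_def, RingHom.comp_apply]
    simp only [coeff_mul, sum_mul, mul_sum, map_sum, map_mul, ← mul_assoc]
    rw [sum_sigma', sum_sigma']
    refine sum_nbij' (fun ⟨⟨_, j⟩, ⟨k, l⟩⟩ => ⟨(k, l + j), (l, j)⟩)
      (fun ⟨⟨i, _⟩, ⟨k, l⟩⟩ => ⟨(i + k, l), (i, k)⟩) ?_ ?_ ?_ ?_ ?_ <;>
    rintro ⟨⟨i, j⟩, ⟨k, l⟩⟩ <;>
    grind [HasAntidiagonal.mem_antidiagonal]

@[simp] theorem monomial_zero_right (i : ℕ) : (monomial i 0 : SkewPowerSeries φ) = 0 :=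
  SkewPowerSeries.ext (Pi.single_zero i)

theorem monomial_add (i : ℕ) (c d : R) :
    (monomial i (c + d) : SkewPowerSeries φ) = monomial i c + monomial i d :=
  SkewPowerSeries.ext (Pi.single_add (f := fun _ => R) i c d)

theorem monomial_mul_monomial (i j : ℕ) (c d : R) :
    (monomial i c * monomial j d : SkewPowerSeries φ) = monomial (i + j) (c * (φ ^ i) d) := by
  refine ext_coeff fun n => ?_
  simp only [coeff_monomial_mul, coeff_monomial]
  grind [mul_zero]

/-- The embedding of the scalars. -/
def C (φ : R →+* R) : R →+* SkewPowerSeries φ where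
  toFun := monomial 0
  map_zero' := monomial_zero_right 0
  map_one' := rfl
  map_add' := monomial_add 0
  map_mul' c d := by simp [monomial_mul_monomial]

theorem C_apply (c : R) : C φ c = monomial 0 c := rfl

theorem coeff_mul_C (f : SkewPowerSeries φ) (c : R) (n : ℕ) :
    (f * C φ c).coeff n = f.coeff n * (φ ^ n) c :=
  coeff_mul_monomial_zero ..

/-- The coefficient of `τ ^ 0`. -/
def constantCoeff (φ : R →+* R) : SkewPowerSeries φ →+* R where
  toFun f := f.coeff 0
  map_zero' := rfl
  map_one' := rfl
  map_add' _ _ := rfl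
  map_mul' f g := by simp [coeff_mul]

/-- `f` is a polynomial in `τ` with leading term `τ ^ d`. -/
def IsMonicOfDegree (f : SkewPowerSeries φ) (d : ℕ) : Prop :=
  f.coeff d = 1 ∧ ∀ n, d < n → f.coeff n = 0

theorem isMonicOfDegree_monomial_one (d : ℕ) :
    (monomial d 1 : SkewPowerSeries φ).IsMonicOfDegree d :=
  ⟨by simp [coeff_monomial], fun _ hn => by simp [coeff_monomial, hn.ne']⟩

theorem IsMonicOfDegree.add_of_forall_coeff_eq_zero {f g : SkewPowerSeries φ} {d : ℕ}
    (hf : f.IsMonicOfDegree d) (hg : ∀ n, d ≤ n → g.coeff n = 0) : (g + f).IsMonicOfDegree d :=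
  ⟨by simp [hf.1, hg d le_rfl], fun n hn => by simp [hf.2 n hn, hg n hn.le]⟩

theorem IsMonicOfDegree.mul {f g : SkewPowerSeries φ} {d e : ℕ} (hf : f.IsMonicOfDegree d)
    (hg : g.IsMonicOfDegree e) : (f * g).IsMonicOfDegree (d + e) := by
  have eq_zero {n : ℕ} (p : ℕ × ℕ) (hp : p ∈ antidiagonal n) (hn : d + e ≤ n) (hne : p ≠ (d, e)) :
      f.coeff p.1 * (φ ^ p.1) (g.coeff p.2) = 0 := by
    rw [HasAntidiagonal.mem_antidiagonal] at hp
    obtain h | h : d < p.1 ∨ e < p.2 := by grind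
    · simp [hf.2 _ h]
    · simp [hg.2 _ h]
  refine ⟨?_, fun n hn => sum_eq_zero fun p hp => eq_zero p hp hn.le ?_⟩
  · rw [coeff_mul, sum_eq_single (d, e) (fun p hp => eq_zero p hp le_rfl) (by simp)]
    simp [hf.1, hg.1]
  · rintro rfl
    exact hn.ne (HasAntidiagonal.mem_antidiagonal.1 hp)

theorem IsMonicOfDegree.pow {f : SkewPowerSeries φ} {d : ℕ} (hf : f.IsMonicOfDegree d) (m : ℕ) :
    (f ^ m).IsMonicOfDegree (m * d) := by
  induction m with
  | zero =>
    rw [pow_zero, zero_mul]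
    exact isMonicOfDegree_monomial_one 0
  | succ m ih => simpa [pow_succ, add_mul] using ih.mul hf

end Semiring

section Inverse

variable {R : Type*} [Ring R] {φ : R →+* R}

/-- The coefficients of `rightInverse f`: solving `f * g = 1` for the coefficient of `τ ^ (n + 1)`
in `g` needs no division because `f` has constant coefficient `1`. -/
def rightInverseCoeff (f : SkewPowerSeries φ) : ℕ → R
  | 0 => 1
  | n + 1 => -∑ i : Fin (n + 1), f.coeff (i + 1) * (φ ^ (i + 1 : ℕ)) (rightInverseCoeff f (n - i))
decreasing_by omega

/-- The right inverse of a skew power series with constant coefficient `1`. -/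
def rightInverse (f : SkewPowerSeries φ) : SkewPowerSeries φ := ⟨rightInverseCoeff f⟩

@[simp] theorem coeff_rightInverse_zero (f : SkewPowerSeries φ) :
    f.rightInverse.coeff 0 = 1 := by
  simp only [rightInverse, rightInverseCoeff]

theorem mul_rightInverse {f : SkewPowerSeries φ} (hf : f.coeff 0 = 1) :
    f * f.rightInverse = 1 := by
  refine ext_coeff fun n => ?_
  rw [coeff_mul, coeff_one]
  rcases n with _ | n
  · simp [hf]
  · rw [Nat.sum_antidiagonal_succ, Nat.sum_antidiagonal_eq_sum_range_succ_mk, sum_range]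
    simp [hf, rightInverse, rightInverseCoeff]

end Inverse

section OfSkewPolynomial

variable {R S : Type*} [Semiring R] [MulSemiringAction (Multiplicative ℕ) R] [Semiring S]
  {φ : S →+* S}

/-- A ring homomorphism `f : R →+* S` that turns the action of `τ` on `R` into `φ` extends to a
ring homomorphism from the skew polynomials over `R` to the skew power series over `S`. -/
def ofSkewPolynomial (f : R →+* S) (hf : ∀ n r, f (Multiplicative.ofAdd n • r) = (φ ^ n) (f r)) :
    SkewPolynomial R →+* SkewPowerSeries φ :=
  SkewMonoidAlgebra.liftNCRingHom ((C φ).comp f)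
    { toFun := fun n => monomial n.toAdd 1
      map_one' := rfl
      map_mul' := fun m n => by simp [monomial_mul_monomial] }
    fun {r n} => by
      simpa [C_apply, monomial_mul_monomial] using congrArg (monomial n.toAdd) (hf n.toAdd r)

theorem ofSkewPolynomial_monomial (f : R →+* S)
    (hf : ∀ n r, f (Multiplicative.ofAdd n • r) = (φ ^ n) (f r)) (i : ℕ) (c : R) :
    ofSkewPolynomial f hf (SkewPolynomial.monomial i c) = monomial i (f c) := by
  rw [SkewPolynomial.monomial_def]
  refine (SkewMonoidAlgebra.liftNC_single ..).trans ?_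
  simp [C_apply, monomial_mul_monomial]

end OfSkewPolynomial

end SkewPowerSeries

theorem frobenius_pow_apply {R : Type*} [CommSemiring R] (p : ℕ) [ExpChar R p] (n : ℕ) (c : R) :
    (frobenius R p ^ n) c = c ^ p ^ n := by
  rw [RingHom.coe_pow, iterate_frobenius]

/-! ### Additive power series -/

section LinearSeries

open SkewPowerSeries hiding coeff
open scoped PowerSeries
open PowerSeries (coeff subst rescale X HasSubst coeff_mk coeff_C_mul coeff_rescale coeff_X)

section Field

variable {L : Type*} [Field L]

theorem coeff_linearSeries_two_pow (c : ℕ → L) (m : ℕ) : coeff (2 ^ m) (linearSeries c) = c m := by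
  simp [linearSeries, Nat.log_pow]

theorem coeff_linearSeries_of_ne (c : ℕ → L) {n : ℕ} (hn : ∀ m, n ≠ 2 ^ m) :
    coeff n (linearSeries c) = 0 := by
  rw [linearSeries, coeff_mk, if_neg (hn _)]

theorem eq_linearSeries_iff {f : L⟦X⟧} {c : ℕ → L} :
    f = linearSeries c ↔
      (∀ m, coeff (2 ^ m) f = c m) ∧ ∀ n, (∀ m, n ≠ 2 ^ m) → coeff n f = 0 := by
  constructor
  · rintro rfl
    exact ⟨coeff_linearSeries_two_pow c, fun n => coeff_linearSeries_of_ne c⟩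
  · rintro ⟨h₁, h₂⟩
    ext n
    by_cases! hn : ∃ m, n = 2 ^ m
    · obtain ⟨m, rfl⟩ := hn
      rw [h₁, coeff_linearSeries_two_pow]
    · rw [h₂ n hn, coeff_linearSeries_of_ne c hn]

theorem linearSeries_injective : Function.Injective (linearSeries (L := L)) := fun c d h =>
  funext fun m => by rw [← coeff_linearSeries_two_pow c, h, coeff_linearSeries_two_pow]

theorem constantCoeff_linearSeries (c : ℕ → L) :
    PowerSeries.constantCoeff (linearSeries c) = 0 := by
  rw [← PowerSeries.coeff_zero_eq_constantCoeff_apply]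
  exact coeff_linearSeries_of_ne c fun m => (pow_pos two_pos m).ne

theorem linearSeries_add (c d : ℕ → L) :
    linearSeries (c + d) = linearSeries c + linearSeries d := by
  ext n
  simp only [linearSeries, map_add, coeff_mk, Pi.add_apply]
  split_ifs <;> simp

theorem linearSeries_zero : linearSeries (0 : ℕ → L) = 0 := by
  ext n
  simp [linearSeries]

theorem coeff_subst_linearSeries (c : ℕ → L) {g : L⟦X⟧} (hg : HasSubst g) (n : ℕ) :
    coeff n (subst g (linearSeries c)) = ∑ᶠ i, c i * coeff n (g ^ 2 ^ i) := by
  have summand_two_pow (i : ℕ) : c i * coeff n (g ^ 2 ^ i) =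
      coeff (2 ^ i) (linearSeries c) • coeff n (g ^ 2 ^ i) := by
    rw [coeff_linearSeries_two_pow, smul_eq_mul]
  have support_subset : (Function.support fun m => coeff m (linearSeries c) • coeff n (g ^ m)) ⊆
      Set.range fun i : ℕ => 2 ^ i := by
    intro m hm
    by_contra! h
    exact hm (by simp [coeff_linearSeries_of_ne c (n := m) (by grind)])
  simp_rw [summand_two_pow]
  rw [PowerSeries.coeff_subst' hg, ← finsum_mem_range (Nat.pow_right_injective le_rfl)
    (f := fun m => coeff m (linearSeries c) • coeff n (g ^ m)), finsum_mem_def,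
    Set.indicator_eq_self.2 support_subset]

end Field

section CharTwo

variable {L : Type*} [Field L] [CharP L 2]

theorem linearSeries_one : linearSeries (1 : SkewPowerSeries (frobenius L 2)).coeff = X := by
  symm
  rw [eq_linearSeries_iff]
  refine ⟨fun m => ?_, fun n hn => ?_⟩
  · simp [coeff_X, coeff_one]
  · rw [coeff_X, if_neg (by simpa using hn 0)]

theorem rescale_linearSeries (f : SkewPowerSeries (frobenius L 2)) (c : L) :
    rescale c (linearSeries f.coeff) = linearSeries (f * C (frobenius L 2) c).coeff := by
  rw [eq_linearSeries_iff]
  refine ⟨fun m => ?_, fun n hn => ?_⟩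
  · rw [coeff_rescale, coeff_linearSeries_two_pow, coeff_mul_C, frobenius_pow_apply, mul_comm]
  · rw [coeff_rescale, coeff_linearSeries_of_ne _ hn, mul_zero]

theorem coeff_pow_two_pow (f : L⟦X⟧) (i n : ℕ) :
    coeff n (f ^ 2 ^ i) = if 2 ^ i ∣ n then coeff (n / 2 ^ i) f ^ 2 ^ i else 0 := by
  have h : PowerSeries.map (iterateFrobenius L 2 i)
      (PowerSeries.expand (2 ^ i) (pow_ne_zero i two_ne_zero) f) = f ^ 2 ^ i :=
    MvPowerSeries.map_iterateFrobenius_expand 2 two_ne_zero (f : MvPowerSeries Unit L) i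
  rw [← h, PowerSeries.coeff_map, PowerSeries.coeff_expand, iterateFrobenius_def]
  split_ifs <;> simp

theorem C_mul_linearSeries_pow (f : SkewPowerSeries (frobenius L 2)) (i : ℕ) (c : L) :
    PowerSeries.C c * linearSeries f.coeff ^ 2 ^ i = linearSeries (monomial i c * f).coeff := by
  rw [eq_linearSeries_iff]
  refine ⟨fun m => ?_, fun n hn => ?_⟩
  · simp only [coeff_C_mul, coeff_pow_two_pow, coeff_monomial_mul, mul_ite, mul_zero,
      Nat.pow_dvd_pow_iff_le_right one_lt_two, frobenius_pow_apply]
    split_ifs with h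
    · rw [Nat.pow_div h two_pos, coeff_linearSeries_two_pow]
    · rfl
  · rw [coeff_C_mul, coeff_pow_two_pow]
    split_ifs with h
    · obtain ⟨q, rfl⟩ := h
      have hq : ∀ m, q ≠ 2 ^ m := fun m h => hn (i + m) (by rw [h, pow_add])
      simp [coeff_linearSeries_of_ne _ hq]
    · simp

theorem subst_linearSeries (f g : SkewPowerSeries (frobenius L 2)) :
    subst (linearSeries g.coeff) (linearSeries f.coeff) = linearSeries (f * g).coeff := by
  have hg : HasSubst (linearSeries g.coeff) :=
    HasSubst.of_constantCoeff_zero' (constantCoeff_linearSeries _)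
  have coeff_summand (n i : ℕ) : f.coeff i * coeff n (linearSeries g.coeff ^ 2 ^ i) =
      coeff n (linearSeries (monomial i (f.coeff i) * g).coeff) := by
    rw [← C_mul_linearSeries_pow, coeff_C_mul]
  rw [eq_linearSeries_iff]
  simp only [coeff_subst_linearSeries _ hg, coeff_summand]
  refine ⟨fun m => ?_, fun n hn => ?_⟩
  · simp only [coeff_linearSeries_two_pow, coeff_monomial_mul]
    rw [finsum_eq_sum_of_support_subset (s := Finset.range (m + 1)), coeff_mul,
      Finset.Nat.sum_antidiagonal_eq_sum_range_succ_mk]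
    · exact Finset.sum_congr rfl fun i hi => if_pos (Finset.mem_range_succ_iff.1 hi)
    · intro i hi
      simpa [Nat.lt_succ_iff] using (ite_ne_right_iff.1 hi).1
  · simp [coeff_linearSeries_of_ne _ hn]

theorem isLogarithm_linearSeries_iff {f g : SkewPowerSeries (frobenius L 2)} (hf : f.coeff 0 = 1)
    (hfg : f * g = 1) {l : L⟦X⟧} :
    IsLogarithm (linearSeries f.coeff) l ↔ l = linearSeries g.coeff := by
  have hunit : IsUnit (coeff 1 (linearSeries f.coeff)) := by
    rw [← pow_zero 2, coeff_linearSeries_two_pow, hf]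
    exact isUnit_one
  let := hunit.invertible
  -- `substInv` is a left inverse, so every right inverse is equal to it.
  have eq_substInv (l : L⟦X⟧) (hl : IsLogarithm (linearSeries f.coeff) l) :
      l = PowerSeries.substInv (linearSeries f.coeff) := by
    have hsl : HasSubst l := HasSubst.of_constantCoeff_zero' hl.constantCoeff_eq_zero
    have hsf : HasSubst (linearSeries f.coeff) :=
      HasSubst.of_constantCoeff_zero' (constantCoeff_linearSeries _)
    have h := PowerSeries.subst_comp_subst_apply hsf hsl
      (PowerSeries.substInv (linearSeries f.coeff))
    rwa [PowerSeries.subst_substInv_left _ (constantCoeff_linearSeries _), PowerSeries.subst_X hsl,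
      hl.subst_eq_X, PowerSeries.X_subst] at h
  have hg : IsLogarithm (linearSeries f.coeff) (linearSeries g.coeff) :=
    ⟨constantCoeff_linearSeries _, by rw [subst_linearSeries, hfg, linearSeries_one]⟩
  exact ⟨fun hl => (eq_substInv l hl).trans (eq_substInv _ hg).symm, fun h => h ▸ hg⟩

end CharTwo

end LinearSeries

/-! ### Linearized polynomials -/

section Linearized

open Polynomial

section Semiring

variable {R : Type*} [Semiring R] {p : ℕ}

variable (R p) in
/-- The linearized polynomials `∑ i, c i * X ^ p ^ i`. In characteristic `p` these are the additive
polynomials. -/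
def linearizedPolynomials : Submodule R R[X] where
  carrier := {f | ∀ n, (∀ m, n ≠ p ^ m) → f.coeff n = 0}
  zero_mem' _ _ := coeff_zero _
  add_mem' hf hg n hn := by rw [coeff_add, hf n hn, hg n hn, add_zero]
  smul_mem' c f hf n hn := by rw [coeff_smul, hf n hn, smul_zero]

theorem X_pow_mem_linearizedPolynomials (m : ℕ) : X ^ p ^ m ∈ linearizedPolynomials R p :=
  fun n hn => by rw [coeff_X_pow, if_neg (hn m)]

theorem map_mem_linearizedPolynomials {S : Type*} [Semiring S] (φ : R →+* S) {f : R[X]}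
    (hf : f ∈ linearizedPolynomials R p) : f.map φ ∈ linearizedPolynomials S p := fun n hn => by
  rw [coeff_map, hf n hn, map_zero]

theorem natDegree_le_of_mem_linearizedPolynomials (hp : 1 < p) {f : R[X]}
    {m : ℕ} (hf : f ∈ linearizedPolynomials R p) (h_deg : f.natDegree ≤ p ^ (m + 1))
    (h_coeff : f.coeff (p ^ (m + 1)) = 0) : f.natDegree ≤ p ^ m := by
  refine natDegree_le_iff_coeff_eq_zero.2 fun n hn => ?_
  by_cases! hm : ∃ i, n = p ^ i
  · obtain ⟨i, rfl⟩ := hm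
    rcases (Nat.succ_le_of_lt ((Nat.pow_lt_pow_iff_right hp).1 hn)).eq_or_lt with rfl | hi
    · exact h_coeff
    · exact coeff_eq_zero_of_natDegree_lt (h_deg.trans_lt (Nat.pow_lt_pow_right hp hi))
  · exact hf n hm

end Semiring

section CommSemiring

variable {R : Type*} [CommSemiring R] {p : ℕ} [Fact p.Prime] [CharP R p]

theorem coeff_pow_char (f : R[X]) (n : ℕ) :
    (f ^ p).coeff n = if p ∣ n then f.coeff (n / p) ^ p else 0 := by
  have hp : 0 < p := (Fact.out : p.Prime).pos
  rw [← map_frobenius_expand p f, coeff_map, coeff_expand hp]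
  split_ifs
  · rfl
  · rw [map_zero]

theorem coeff_pow_char_mul (f : R[X]) (n : ℕ) : (f ^ p).coeff (n * p) = f.coeff n ^ p := by
  rw [coeff_pow_char, if_pos (dvd_mul_left p n), Nat.mul_div_cancel n (Fact.out : p.Prime).pos]

theorem coeff_one_pow_char (f : R[X]) : (f ^ p).coeff 1 = 0 := by
  rw [coeff_pow_char, if_neg (Fact.out : p.Prime).not_dvd_one]

theorem pow_char_mem_linearizedPolynomials {f : R[X]} (hf : f ∈ linearizedPolynomials R p) :
    f ^ p ∈ linearizedPolynomials R p := by
  intro n hn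
  rw [coeff_pow_char]
  split_ifs with h
  · obtain ⟨q, rfl⟩ := h
    have hp : p ≠ 0 := (Fact.out : p.Prime).ne_zero
    rw [Nat.mul_div_cancel_left q hp.bot_lt,
      hf q fun m hm => hn (m + 1) (by rw [hm, pow_succ']), zero_pow hp]
  · rfl

end CommSemiring

section CommRing

variable {R : Type*} [CommRing R] {p : ℕ} [Fact p.Prime] [CharP R p]

theorem comp_X_sub_C_of_mem_linearizedPolynomials {f : R[X]}
    (hf : f ∈ linearizedPolynomials R p) (b : R) : f.comp (X - C b) = f - C (f.eval b) := by
  conv_lhs => rw [f.as_sum_support_C_mul_X_pow]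
  conv_rhs => rw [f.as_sum_support_C_mul_X_pow]
  rw [eval_finsetSum, map_sum, ← Finset.sum_sub_distrib, comp, eval₂_finsetSum]
  refine Finset.sum_congr rfl fun n hn => ?_
  obtain ⟨m, rfl⟩ : ∃ m, n = p ^ m := by
    by_contra! h
    exact mem_support_iff.1 hn (hf n h)
  simp [sub_pow_char_pow, mul_sub]

/-- Subtracting from `f` the multiple of `g ^ p` that cancels its coefficient of `X ^ p ^ (m + 1)`
leaves a linearized multiple of `g` of degree at most `p ^ m`. -/
theorem exists_eq_smul_pow_char_add_smul_of_dvd {f g : R[X]} {m : ℕ}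
    (hf : f ∈ linearizedPolynomials R p) (hg : g ∈ linearizedPolynomials R p) (hg_monic : g.Monic)
    (hg_deg : g.natDegree = p ^ m) (hf_deg : f.natDegree ≤ p ^ (m + 1)) (hdvd : g ∣ f) :
    ∃ μ : R, f = f.coeff (p ^ (m + 1)) • g ^ p + μ • g := by
  have hp : 1 < p := (Fact.out : p.Prime).one_lt
  set r := f - f.coeff (p ^ (m + 1)) • g ^ p with hr
  have r_mem : r ∈ linearizedPolynomials R p :=
    sub_mem hf (Submodule.smul_mem _ _ (pow_char_mem_linearizedPolynomials hg))
  have g_coeff : g.coeff (p ^ m) = 1 := hg_deg ▸ hg_monic.coeff_natDegree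
  have r_coeff : r.coeff (p ^ (m + 1)) = 0 := by
    rw [hr, coeff_sub, coeff_smul, pow_succ p m, coeff_pow_char_mul, g_coeff, one_pow, smul_eq_mul,
      mul_one, sub_self]
  have r_deg : r.natDegree ≤ p ^ (m + 1) := by
    refine (natDegree_sub_le _ _).trans (max_le hf_deg ((natDegree_smul_le (f.coeff _) _).trans ?_))
    rw [hg_monic.natDegree_pow, hg_deg, pow_succ']
  have r_dvd : g ∣ r :=
    dvd_sub hdvd (smul_eq_C_mul (f.coeff _) ▸ dvd_mul_of_dvd_right (dvd_pow_self g hp.ne_bot) _)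
  refine ⟨r.leadingCoeff, ?_⟩
  rw [smul_eq_C_mul r.leadingCoeff, ← eq_leadingCoeff_mul_of_monic_of_dvd_of_natDegree_le hg_monic
    r_dvd (hg_deg ▸ natDegree_le_of_mem_linearizedPolynomials hp r_mem r_deg r_coeff), hr,
    add_sub_cancel]

end CommRing

end Linearized

/-! ### The degree -/

section Degree

open Polynomial

theorem deg_zero : deg 0 = ⊥ := by simpa using deg_smul_basis 0 0

theorem deg_one : deg 1 = 0 := by simp [deg]

theorem deg_pow (a : A) (n : ℕ) : deg (a ^ n) = n • deg a := by simp [deg]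

theorem deg_prod {ι : Type*} (s : Finset ι) (f : ι → A) :
    deg (∏ i ∈ s, f i) = ∑ i ∈ s, deg (f i) := by
  simp only [deg, map_prod, degree_prod]

theorem deg_eq_bot_iff {a : A} : deg a = ⊥ ↔ a = 0 := by
  have := Module.Finite.of_basis (WeierstrassCurve.Affine.CoordinateRing.basis curve)
  rw [deg, degree_eq_bot, Algebra.norm_eq_zero_iff]

theorem exists_deg_eq_natCast {a : A} (ha : a ≠ 0) : ∃ n : ℕ, deg a = n :=
  (WithBot.ne_bot_iff_exists.1 (deg_eq_bot_iff.not.2 ha)).imp fun _ => Eq.symm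

theorem ne_zero_of_deg_eq_natCast {a : A} {n : ℕ} (ha : deg a = n) : a ≠ 0 := by
  rintro rfl
  exact WithBot.coe_ne_bot (ha.symm.trans deg_zero)

theorem deg_ne_one (a : A) : deg a ≠ 1 :=
  WeierstrassCurve.Affine.CoordinateRing.degree_norm_ne_one a

theorem exists_x_pow_mul_y_pow_deg_eq {n : ℕ} (hn : n ≠ 1) :
    ∃ i j, n = i * 2 + j * 3 ∧ deg (x ^ i * y ^ j) = n := by
  obtain ⟨i, j, rfl⟩ : ∃ i j, n = i * 2 + j * 3 := by
    rcases Nat.even_or_odd' n with ⟨m, rfl | rfl⟩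
    · exact ⟨m, 0, by ring⟩
    · exact ⟨m - 1, 1, by lia⟩
  refine ⟨i, j, rfl, ?_⟩
  rw [deg_mul, deg_pow, deg_pow, deg_x, deg_y]
  simp

theorem two_nsmul_degree_add_lt_iff {R : Type*} [Semiring R] (p : R[X]) (k n : ℕ) :
    2 • p.degree + (k : WithBot ℕ) < (n : WithBot ℕ) ↔ ∀ i, n ≤ 2 * i + k → p.coeff i = 0 := by
  by_cases hp : p = 0
  · simp [hp]
  · rw [degree_eq_natDegree hp, two_nsmul]
    norm_cast
    constructor
    · exact fun h i hi => coeff_eq_zero_of_natDegree_lt (by lia)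
    · intro h
      by_contra! hn
      exact hp (leadingCoeff_eq_zero.1 (h p.natDegree (by lia)))

/-- The coordinates of an element in the basis `1, y` of `A` over `𝔽₂[x]`. -/
def coord (i : Fin 2) : A →ₗ[(ZMod 2)[X]] (ZMod 2)[X] :=
  (WeierstrassCurve.Affine.CoordinateRing.basis curve).coord i

theorem coord_zero_smul_add_coord_one_smul (a : A) :
    coord 0 a • (1 : A) + coord 1 a • y = a := by
  have h := (WeierstrassCurve.Affine.CoordinateRing.basis curve).sum_repr a
  rwa [Fin.sum_univ_two, WeierstrassCurve.Affine.CoordinateRing.basis_zero,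
    WeierstrassCurve.Affine.CoordinateRing.basis_one] at h

theorem deg_lt_natCast_iff {a : A} {n : ℕ} :
    deg a < n ↔ (∀ i, n ≤ 2 * i → (coord 0 a).coeff i = 0) ∧
      ∀ i, n ≤ 2 * i + 3 → (coord 1 a).coeff i = 0 := by
  have h₀ := two_nsmul_degree_add_lt_iff (coord 0 a) 0 n
  have h₁ := two_nsmul_degree_add_lt_iff (coord 1 a) 3 n
  rw [Nat.cast_zero, add_zero] at h₀
  rw [← h₁]
  nth_rw 1 [← coord_zero_smul_add_coord_one_smul a]
  rw [deg_smul_basis, max_lt_iff, h₀]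
  rfl

/-- The map is a coordinate with respect to the `𝔽₂`-basis of the `x ^ i` and `x ^ i * y`, whose
elements have pairwise distinct degrees. -/
theorem exists_addMonoidHom_eq_zero_iff_deg_lt (n : ℕ) :
    ∃ c : A →+ ZMod 2, ∀ a, deg a = n → (c a = 0 ↔ deg a < n) := by
  have coeff_eq_zero (a : A) (ha : deg a = n) := (deg_lt_natCast_iff (a := a) (n := n + 1)).1
    (ha.trans_lt (by exact_mod_cast n.lt_succ_self))
  simp only [deg_lt_natCast_iff (n := n)]
  obtain ⟨m, rfl⟩ | rfl | ⟨m, rfl⟩ : (∃ m, n = 2 * m) ∨ n = 1 ∨ ∃ m, n = 2 * m + 3 := by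
    rcases Nat.even_or_odd' n with ⟨m | m, rfl | rfl⟩
    · exact .inl ⟨0, rfl⟩
    · exact .inr (.inl rfl)
    · exact .inl ⟨_, rfl⟩
    · exact .inr (.inr ⟨m, by ring⟩)
  · exact ⟨(lcoeff _ m).toAddMonoidHom.comp (coord 0).toAddMonoidHom, fun a ha => by
      simp only [AddMonoidHom.comp_apply, LinearMap.toAddMonoidHom_coe, lcoeff_apply]
      grind⟩
  · exact ⟨0, fun a ha => absurd ha (deg_ne_one a)⟩
  · exact ⟨(lcoeff _ m).toAddMonoidHom.comp (coord 1).toAddMonoidHom, fun a ha => by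
      simp only [AddMonoidHom.comp_apply, LinearMap.toAddMonoidHom_coe, lcoeff_apply]
      grind⟩

theorem deg_add_lt_of_deg_eq {a b : A} {n : ℕ} (ha : deg a = n) (hb : deg b = n) :
    deg (a + b) < n := by
  obtain ⟨c, hc⟩ := exists_addMonoidHom_eq_zero_iff_deg_lt n
  have eq_one (a : A) (ha : deg a = n) : c a = 1 :=
    Fin.eq_one_of_ne_zero _ (mt (hc a ha).1 ha.not_lt)
  refine lt_of_le_of_ne ((deg_add_le a b).trans (by simp [ha, hb])) fun hab => ?_
  refine (hc _ hab).not.2 hab.not_lt ?_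
  rw [map_add, eq_one a ha, eq_one b hb, CharTwo.add_self_eq_zero]

theorem deg_add_eq_left {a b : A} (h : deg b < deg a) : deg (a + b) = deg a := by
  refine le_antisymm ((deg_add_le a b).trans (max_le le_rfl h.le)) (le_of_not_gt fun hlt => ?_)
  have h' := deg_add_le (a + b) b
  rw [add_assoc, CharTwo.add_self_eq_zero, add_zero] at h'
  exact (h'.trans_lt (max_lt hlt h)).false

theorem deg_add_eq_right {a b : A} (h : deg a < deg b) : deg (a + b) = deg b := by
  rw [add_comm, deg_add_eq_left h]

end Degree

/-! ### The exponential and the logarithm of `ρ` -/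

section Exponential

open SkewPowerSeries hiding coeff

variable {L : Type*} [Field L] [Algebra A L]

instance charP_two_of_algebra : CharP L 2 :=
  CharTwo.of_one_ne_zero_of_two_eq_zero one_ne_zero <| by
    rw [← map_ofNat (algebraMap A L) 2, two_eq_zero, map_zero]

variable (L) in
/-- The Drinfeld module `ρ` with values in the twisted power series over `L`, where `ρ_a` can be
composed with the exponential and the logarithm. -/
def rhoSeries : A →+* SkewPowerSeries (frobenius L 2) :=
  (ofSkewPolynomial (algebraMap A L) fun n r => by
    rw [smul_eq_pow, frobenius_pow_apply, map_pow]).comp rho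

theorem rhoSeries_x : rhoSeries L x = monomial 0 (algebraMap A L x) +
    monomial 1 (algebraMap A L (x ^ 2 + x)) + monomial 2 1 := by
  simp only [rhoSeries, RingHom.comp_apply, rho_x, rhoX, map_add, map_one,
    ofSkewPolynomial_monomial, monomial_add]

theorem rhoSeries_y : rhoSeries L y = monomial 0 (algebraMap A L y) +
    monomial 1 (algebraMap A L (y ^ 2 + y)) + monomial 2 (algebraMap A L (x * (y ^ 2 + y))) +
    monomial 3 1 := by
  simp only [rhoSeries, RingHom.comp_apply, rho_y, rhoY, map_add, map_one,
    ofSkewPolynomial_monomial, monomial_add]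

theorem twistedApply_rho_linearSeries (a : A) (f : SkewPowerSeries (frobenius L 2)) :
    twistedApply (rho a) (linearSeries f.coeff) = linearSeries (rhoSeries L a * f).coeff := by
  rw [rhoSeries, RingHom.comp_apply]
  induction rho a using SkewPolynomial.induction with
  | h0 =>
    rw [map_zero, zero_mul]
    exact (SkewPolynomial.sum_zero_index _).trans linearSeries_zero.symm
  | ha n r q _ _ ih =>
    rw [map_add, add_mul]
    change _ = linearSeries (SkewPowerSeries.coeff _ + SkewPowerSeries.coeff _)
    rw [linearSeries_add, ← ih, ofSkewPolynomial_monomial, ← C_mul_linearSeries_pow]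
    unfold twistedApply
    rw [SkewPolynomial.sum_add_index _ _ _ (by simp) (by intros; simp [add_mul]),
      SkewPolynomial.sum_monomial_index (by simp)]

theorem isExponential_linearSeries_iff (f : SkewPowerSeries (frobenius L 2)) :
    IsExponential (linearSeries f.coeff) ↔ f.coeff 0 = 1 ∧
      ∀ a : A, rhoSeries L a * f = f * C (frobenius L 2) (algebraMap A L a) := by
  have functional_eq_iff (a : A) :
      PowerSeries.rescale (algebraMap A L a) (linearSeries f.coeff) =
        twistedApply (rho a) (linearSeries f.coeff) ↔
      rhoSeries L a * f = f * C (frobenius L 2) (algebraMap A L a) := by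
    rw [rescale_linearSeries, twistedApply_rho_linearSeries, linearSeries_injective.eq_iff, eq_comm,
      SkewPowerSeries.ext_iff]
  simp only [← functional_eq_iff]
  constructor
  · rintro ⟨⟨c, hc, hfc⟩, h⟩
    exact ⟨by rw [linearSeries_injective hfc, hc], h⟩
  · exact fun ⟨h₀, h⟩ => ⟨⟨f.coeff, h₀, rfl⟩, h⟩

theorem coeff_zero_rhoSeries (a : A) : (rhoSeries L a).coeff 0 = algebraMap A L a := by
  suffices h : (constantCoeff (frobenius L 2)).comp (rhoSeries L) = algebraMap A L from
    RingHom.congr_fun h a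
  refine Ideal.Quotient.ringHom_ext
    (Polynomial.ringHom_ext' (Polynomial.ringHom_ext' (Subsingleton.elim _ _) ?_) ?_)
  · change (rhoSeries L x).coeff 0 = algebraMap A L x
    simp [rhoSeries_x, SkewPowerSeries.coeff_add, coeff_monomial]
  · change (rhoSeries L y).coeff 0 = algebraMap A L y
    simp [rhoSeries_y, SkewPowerSeries.coeff_add, coeff_monomial]

variable (L) in
/-- The coefficients of the exponential of `ρ`, by the recursion that comparing coefficients in
`e(x z) = ρ_x(e(z))` gives. -/
def expCoeff : ℕ → L
  | 0 => 1
  | 1 => 1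
  | n + 2 => (algebraMap A L (x ^ 2 + x) * expCoeff (n + 1) ^ 2 + expCoeff n ^ 4) /
      (algebraMap A L x ^ 2 ^ (n + 2) - algebraMap A L x)

variable (L) in
/-- The exponential of `ρ` as a twisted power series. -/
def expSeries : SkewPowerSeries (frobenius L 2) := ⟨expCoeff L⟩

variable (L) in
/-- The logarithm of `ρ` as a twisted power series. -/
def logSeries : SkewPowerSeries (frobenius L 2) := (expSeries L).rightInverse

theorem expSeries_mul_logSeries : expSeries L * logSeries L = 1 := mul_rightInverse rfl

theorem isLogarithm_iff {l : PowerSeries L} :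
    IsLogarithm (linearSeries (expCoeff L)) l ↔ l = linearSeries (logSeries L).coeff :=
  isLogarithm_linearSeries_iff rfl expSeries_mul_logSeries

theorem coeff_zero_logSeries : (logSeries L).coeff 0 = 1 := coeff_rightInverse_zero _

variable [FaithfulSMul A L]

theorem algebraMap_x_pow_sub_ne_zero (n : ℕ) :
    algebraMap A L x ^ 2 ^ (n + 1) - algebraMap A L x ≠ 0 := by
  rw [sub_ne_zero, ← map_pow, (FaithfulSMul.algebraMap_injective A L).ne_iff]
  intro h
  have h_deg := congrArg deg h
  rw [deg_pow, deg_x] at h_deg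
  have h_two : 2 ^ (n + 1) * 2 = 2 := by exact_mod_cast (nsmul_eq_mul _ _).symm.trans h_deg
  have := Nat.one_lt_two_pow n.succ_ne_zero
  lia

theorem rhoSeries_x_mul_eq_iff (f : SkewPowerSeries (frobenius L 2)) :
    rhoSeries L x * f = f * C (frobenius L 2) (algebraMap A L x) ↔
      f.coeff 1 = f.coeff 0 ^ 2 ∧
      ∀ n, f.coeff (n + 2) = (algebraMap A L (x ^ 2 + x) * f.coeff (n + 1) ^ 2 + f.coeff n ^ 4) /
        (algebraMap A L x ^ 2 ^ (n + 2) - algebraMap A L x) := by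
  have h_x : algebraMap A L x ^ 2 - algebraMap A L x ≠ 0 := algebraMap_x_pow_sub_ne_zero 0
  have h_two : (2 : L) = 0 := CharTwo.two_eq_zero
  rw [SkewPowerSeries.ext_iff, funext_iff, ← Nat.and_forall_add_one, ← Nat.and_forall_add_one]
  simp only [rhoSeries_x, add_mul, SkewPowerSeries.coeff_add, coeff_monomial_mul, coeff_mul_C,
    frobenius_pow_apply]
  rw [and_iff_right (by simp [mul_comm])]
  refine and_congr (Iff.trans ?_ (mul_right_inj' h_x)) (forall_congr' fun n => ?_)
  · simp only [Nat.zero_add, zero_le, le_refl, Nat.not_ofNat_le_one, if_true, if_false, map_add,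
      map_pow, Nat.sub_zero, Nat.sub_self, pow_zero, pow_one]
    constructor <;> intro h <;>
      linear_combination -h + algebraMap A L x * f.coeff 0 ^ 2 * h_two
  · rw [eq_div_iff (algebraMap_x_pow_sub_ne_zero _)]
    simp only [zero_le, le_add_iff_nonneg_left, if_true, Nat.reduceSubDiff, Nat.sub_zero,
      Nat.add_sub_cancel, pow_zero, pow_one, Nat.add_assoc, Nat.reduceAdd]
    constructor <;> intro h <;> linear_combination -h

theorem eq_of_rhoSeries_x_mul_eq {f g : SkewPowerSeries (frobenius L 2)}
    (hf : rhoSeries L x * f = f * C (frobenius L 2) (algebraMap A L x))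
    (hg : rhoSeries L x * g = g * C (frobenius L 2) (algebraMap A L x))
    (h₀ : f.coeff 0 = g.coeff 0) : f = g := by
  obtain ⟨hf₁, hf⟩ := (rhoSeries_x_mul_eq_iff f).1 hf
  obtain ⟨hg₁, hg⟩ := (rhoSeries_x_mul_eq_iff g).1 hg
  refine ext_coeff fun n => ?_
  induction n using Nat.twoStepInduction with
  | zero => exact h₀
  | one => rw [hf₁, hg₁, h₀]
  | more n ih ih' => rw [hf, hg, ih, ih']

theorem rhoSeries_mul_expSeries (a : A) :
    rhoSeries L a * expSeries L = expSeries L * C (frobenius L 2) (algebraMap A L a) := by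
  have h_x : rhoSeries L x * expSeries L = expSeries L * C (frobenius L 2) (algebraMap A L x) :=
    (rhoSeries_x_mul_eq_iff _).2 ⟨(one_pow 2).symm, fun _ => rfl⟩
  -- Both sides intertwine `x` with `ρ_x`, because `a` and `x` commute in `A`.
  refine eq_of_rhoSeries_x_mul_eq ?_ ?_ ?_
  · rw [← mul_assoc, ← map_mul, mul_comm x a, map_mul, mul_assoc, h_x, mul_assoc]
  · rw [← mul_assoc, h_x, mul_assoc, mul_assoc, ← map_mul, ← map_mul, ← map_mul, ← map_mul,
      mul_comm x a]
  · simp [coeff_mul, coeff_zero_rhoSeries, C_apply, coeff_monomial, mul_comm]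

theorem isExponential_iff {e : PowerSeries L} :
    IsExponential e ↔ e = linearSeries (expCoeff L) := by
  constructor
  · intro he
    obtain ⟨c, -, rfl⟩ := he.linear
    obtain ⟨h₀, h⟩ := (isExponential_linearSeries_iff ⟨c⟩).1 he
    have h_eq : ⟨c⟩ = expSeries L := eq_of_rhoSeries_x_mul_eq (h x) (rhoSeries_mul_expSeries x) h₀
    exact congrArg (fun f : SkewPowerSeries _ => linearSeries f.coeff) h_eq
  · rintro rfl
    exact (isExponential_linearSeries_iff (expSeries L)).2 ⟨rfl, rhoSeries_mul_expSeries⟩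

theorem rhoSeries_eq_expSeries_mul_C_mul_logSeries (a : A) :
    rhoSeries L a = expSeries L * C (frobenius L 2) (algebraMap A L a) * logSeries L := by
  rw [← rhoSeries_mul_expSeries, mul_assoc, expSeries_mul_logSeries, mul_one]

end Exponential

/-! ### The degree of `ρ_a` -/

section RhoDegree

open SkewPowerSeries hiding coeff

variable {L : Type*} [Field L] [Algebra A L]

theorem isMonicOfDegree_rhoSeries_x : (rhoSeries L x).IsMonicOfDegree 2 := by
  rw [rhoSeries_x]
  refine (isMonicOfDegree_monomial_one 2).add_of_forall_coeff_eq_zero fun n hn => ?_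
  simp [coeff_monomial, show n ≠ 0 by lia, show n ≠ 1 by lia]

theorem isMonicOfDegree_rhoSeries_y : (rhoSeries L y).IsMonicOfDegree 3 := by
  rw [rhoSeries_y]
  refine (isMonicOfDegree_monomial_one 3).add_of_forall_coeff_eq_zero fun n hn => ?_
  simp [coeff_monomial, show n ≠ 0 by lia, show n ≠ 1 by lia, show n ≠ 2 by lia]

theorem isMonicOfDegree_rhoSeries {a : A} {n : ℕ} (ha : deg a = n) :
    (rhoSeries L a).IsMonicOfDegree n := by
  induction n using Nat.strong_induction_on generalizing a with
  | _ n ih =>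
    obtain ⟨i, j, rfl, hb⟩ := exists_x_pow_mul_y_pow_deg_eq (n := n)
      (fun hn => deg_ne_one a (by rw [ha, hn, Nat.cast_one]))
    set b := x ^ i * y ^ j
    have hb' : (rhoSeries L b).IsMonicOfDegree (i * 2 + j * 3) := by
      rw [map_mul, map_pow, map_pow]
      exact (isMonicOfDegree_rhoSeries_x.pow i).mul (isMonicOfDegree_rhoSeries_y.pow j)
    have hab : deg (a + b) < (i * 2 + j * 3 : ℕ) := deg_add_lt_of_deg_eq ha hb
    rw [← add_zero a, ← CharTwo.add_self_eq_zero b, ← add_assoc, map_add]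
    refine hb'.add_of_forall_coeff_eq_zero fun k hk => ?_
    by_cases h₀ : a + b = 0
    · rw [h₀, map_zero, SkewPowerSeries.coeff_zero]
    · obtain ⟨m, hm⟩ := exists_deg_eq_natCast h₀
      have hmn : m < i * 2 + j * 3 := by rw [hm] at hab; exact_mod_cast hab
      exact (ih m hmn hm).2 k (hmn.trans_le hk)

theorem coeff_rhoSeries_of_deg_eq {a : A} {n : ℕ} (ha : deg a = n) : (rhoSeries L a).coeff n = 1 :=
  (isMonicOfDegree_rhoSeries ha).1

theorem coeff_rhoSeries_of_deg_lt {a : A} {n : ℕ} (ha : deg a < n) :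
    (rhoSeries L a).coeff n = 0 := by
  by_cases h₀ : a = 0
  · rw [h₀, map_zero, SkewPowerSeries.coeff_zero]
  · obtain ⟨m, hm⟩ := exists_deg_eq_natCast h₀
    rw [hm] at ha
    exact (isMonicOfDegree_rhoSeries hm).2 n (by exact_mod_cast ha)

end RhoDegree

/-! ### The vanishing polynomials -/

section VanishingPoly

open Polynomial

/-- The finite set of the elements of `A` of degree less than `n`, including `0`. -/
def degLT (n : ℕ) : Finset A :=
  insert 0 ((Finset.range n).biUnion fun k => (finite_deg_eq k).toFinset)

theorem mem_degLT {a : A} {n : ℕ} : a ∈ degLT n ↔ deg a < n := by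
  by_cases ha : a = 0
  · simp [degLT, ha, deg_zero]
  · obtain ⟨m, hm⟩ := exists_deg_eq_natCast ha
    simp [degLT, ha, hm]

theorem degLT_zero : degLT 0 = {0} := rfl

theorem degLT_two : degLT 2 = degLT 1 := by
  ext a
  by_cases ha : a = 0
  · simp [degLT, ha]
  · obtain ⟨m, hm⟩ := exists_deg_eq_natCast ha
    have hm_one : m ≠ 1 := fun h => deg_ne_one a (by rw [hm, h, Nat.cast_one])
    simp only [mem_degLT, hm, Nat.cast_lt]
    lia

theorem disjoint_degLT (n : ℕ) : Disjoint (degLT n) (finite_deg_eq n).toFinset :=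
  Finset.disjoint_left.2 fun _ ha ha' =>
    (mem_degLT.1 ha).ne ((finite_deg_eq n).mem_toFinset.1 ha')

theorem degLT_succ (n : ℕ) : degLT (n + 1) = (degLT n).disjUnion _ (disjoint_degLT n) := by
  rw [Finset.disjUnion_eq_union, degLT, Finset.range_add_one, Finset.biUnion_insert, degLT,
    Finset.insert_union, Finset.union_comm]

theorem prod_deg_eq {M : Type*} [CommMonoid M] {b : A} {n : ℕ} (hb : deg b = n) (f : A → M) :
    ∏ a ∈ (finite_deg_eq n).toFinset, f a = ∏ c ∈ degLT n, f (b + c) := by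
  refine (Finset.prod_equiv (Equiv.addLeft b) (fun c => ?_) fun c _ => rfl).symm
  rw [mem_degLT, Set.Finite.mem_toFinset, Set.mem_ofPred_eq, Equiv.coe_addLeft]
  refine ⟨fun hc => (deg_add_eq_left (hc.trans_eq hb.symm)).trans hb, fun hbc => ?_⟩
  rw [← zero_add c, ← CharTwo.add_self_eq_zero b, add_assoc]
  exact deg_add_lt_of_deg_eq hb hbc

/-- The monic polynomial with simple roots at the elements of `A` of degree less than `n`. -/
def vanishingPoly (n : ℕ) : A[X] := ∏ c ∈ degLT n, (X - C c)

theorem monic_vanishingPoly (n : ℕ) : (vanishingPoly n).Monic := monic_prod_X_sub_C _ _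

theorem vanishingPoly_zero : vanishingPoly 0 = X := by
  rw [vanishingPoly, degLT_zero, Finset.prod_singleton, C_0, sub_zero]

theorem vanishingPoly_two : vanishingPoly 2 = vanishingPoly 1 := by
  rw [vanishingPoly, degLT_two, vanishingPoly]

theorem eval_vanishingPoly_of_deg_eq {a : A} {n : ℕ} (ha : deg a = n) :
    (vanishingPoly n).eval a = D n := by
  rw [D, prod_deg_eq ha, vanishingPoly, eval_prod]
  simp only [eval_sub, eval_X, eval_C, CharTwo.sub_eq_add a]

theorem D_zero : D 0 = 1 := by
  rw [← eval_vanishingPoly_of_deg_eq (n := 0) deg_one, vanishingPoly_zero, eval_X]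

theorem vanishingPoly_succ_eq_mul_comp {b : A} {n : ℕ} (hb : deg b = n) :
    vanishingPoly (n + 1) = vanishingPoly n * (vanishingPoly n).comp (X - C b) := by
  rw [vanishingPoly, degLT_succ, Finset.prod_disjUnion, prod_deg_eq hb, vanishingPoly, prod_comp]
  simp only [sub_comp, X_comp, C_comp, C_add, sub_sub]

theorem vanishingPoly_succ_of_mem {n : ℕ} (hn : n ≠ 1)
    (h_mem : vanishingPoly n ∈ linearizedPolynomials A 2) :
    vanishingPoly (n + 1) = vanishingPoly n ^ 2 + D n • vanishingPoly n := by
  obtain ⟨i, j, -, hb⟩ := exists_x_pow_mul_y_pow_deg_eq hn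
  rw [vanishingPoly_succ_eq_mul_comp hb, comp_X_sub_C_of_mem_linearizedPolynomials h_mem,
    eval_vanishingPoly_of_deg_eq hb, CharTwo.sub_eq_add, smul_eq_C_mul]
  ring

theorem vanishingPoly_mem_linearizedPolynomials (n : ℕ) :
    vanishingPoly n ∈ linearizedPolynomials A 2 := by
  induction n with
  | zero =>
    simpa only [vanishingPoly_zero, pow_zero, pow_one] using X_pow_mem_linearizedPolynomials 0
  | succ n ih =>
    rcases eq_or_ne n 1 with rfl | hn
    · rwa [vanishingPoly_two]
    · rw [vanishingPoly_succ_of_mem hn ih]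
      exact add_mem (pow_char_mem_linearizedPolynomials ih) (Submodule.smul_mem _ _ ih)

theorem vanishingPoly_succ {n : ℕ} (hn : n ≠ 1) :
    vanishingPoly (n + 1) = vanishingPoly n ^ 2 + D n • vanishingPoly n :=
  vanishingPoly_succ_of_mem hn (vanishingPoly_mem_linearizedPolynomials n)

theorem vanishingPoly_two_eq : vanishingPoly 2 = X ^ 2 + X := by
  rw [vanishingPoly_two, vanishingPoly_succ zero_ne_one, vanishingPoly_zero, D_zero, one_smul]

theorem natDegree_vanishingPoly (n : ℕ) : (vanishingPoly (n + 2)).natDegree = 2 ^ (n + 1) := by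
  induction n with
  | zero =>
    rw [vanishingPoly_two_eq]
    compute_degree!
  | succ n ih =>
    have h_sq : (vanishingPoly (n + 2) ^ 2).natDegree = 2 ^ (n + 2) := by
      rw [natDegree_pow, ih, pow_succ' 2 (n + 1)]
    rw [vanishingPoly_succ (by lia), natDegree_add_eq_left_of_natDegree_lt, h_sq]
    refine (natDegree_smul_le (D _) _).trans_lt ?_
    rw [h_sq, ih]
    exact Nat.pow_lt_pow_right one_lt_two (n + 1).lt_succ_self

theorem coeff_vanishingPoly_two_pow_succ (n : ℕ) :
    (vanishingPoly (n + 2)).coeff (2 ^ (n + 1)) = 1 :=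
  natDegree_vanishingPoly n ▸ (monic_vanishingPoly _).coeff_natDegree

theorem coeff_one_vanishingPoly (n : ℕ) :
    (vanishingPoly (n + 2)).coeff 1 = ∏ i ∈ Finset.Ico 2 (n + 2), D i := by
  induction n with
  | zero =>
    rw [vanishingPoly_two_eq]
    simp [coeff_X_pow]
  | succ n ih =>
    rw [vanishingPoly_succ (by lia), coeff_add, coeff_one_pow_char, zero_add, coeff_smul, ih,
      smul_eq_mul, mul_comm, ← Finset.prod_Ico_succ_top (Nat.le_add_left 2 n)]

/-- The sum `1 + D k + D (k - 1) ^ 2 + ⋯ + D 2 ^ 2 ^ (k - 2)` of the recursion for `d k`. -/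
def sumDPow (k : ℕ) : A := 1 + ∑ i ∈ Finset.Icc 2 k, D i ^ 2 ^ (k - i)

theorem algebraMap_sumDPow {L : Type*} [CommSemiring L] [Algebra A L] (k : ℕ) :
    algebraMap A L (sumDPow k) =
      1 + ∑ i ∈ Finset.Icc 2 k, algebraMap A L (D i) ^ 2 ^ (k - i) := by
  simp [sumDPow]

theorem sumDPow_one : sumDPow 1 = 1 := by simp [sumDPow]

theorem sumDPow_succ {k : ℕ} (hk : 1 ≤ k) : sumDPow (k + 1) = sumDPow k ^ 2 + D (k + 1) := by
  rw [sumDPow, sumDPow, add_pow_char, one_pow, sum_pow_char, Finset.sum_Icc_succ_top (by lia),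
    Nat.sub_self, pow_zero, pow_one, ← add_assoc]
  congr 2
  refine Finset.sum_congr rfl fun i hi => ?_
  rw [← pow_mul, ← pow_succ, Nat.sub_add_comm (Finset.mem_Icc.1 hi).2]

theorem coeff_vanishingPoly_two_pow (n : ℕ) :
    (vanishingPoly (n + 2)).coeff (2 ^ n) = sumDPow (n + 1) := by
  induction n with
  | zero =>
    rw [vanishingPoly_two_eq, sumDPow_one]
    simp [coeff_X_pow]
  | succ n ih =>
    rw [vanishingPoly_succ (by lia), coeff_add, pow_succ 2 n, coeff_pow_char_mul, ih, ← pow_succ 2,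
      coeff_smul, coeff_vanishingPoly_two_pow_succ, smul_eq_mul, mul_one, sumDPow_succ n.succ_pos]

end VanishingPoly

/-! ### The coefficients of `ρ_a` as polynomials in `a` -/

section Comparison

open Polynomial

variable (L : Type*) [Field L] [Algebra A L]

/-- The `k`-th coefficient of `e * C z * log` as a polynomial in `z`. By
`rhoSeries_eq_expSeries_mul_C_mul_logSeries`, its value at `a ∈ A` is the coefficient of `τ ^ k`
in `ρ_a`. -/
def rhoCoeffPoly (k : ℕ) : L[X] :=
  ∑ i ∈ Finset.range (k + 1),
    C (expCoeff L i * (logSeries L).coeff (k - i) ^ 2 ^ i) * X ^ 2 ^ i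

variable {L}

theorem eval_rhoCoeffPoly [FaithfulSMul A L] (k : ℕ) (a : A) :
    (rhoCoeffPoly L k).eval (algebraMap A L a) = (rhoSeries L a).coeff k := by
  rw [rhoSeries_eq_expSeries_mul_C_mul_logSeries, SkewPowerSeries.coeff_mul, rhoCoeffPoly,
    eval_finsetSum, Finset.Nat.sum_antidiagonal_eq_sum_range_succ_mk]
  refine Finset.sum_congr rfl fun i _ => ?_
  rw [SkewPowerSeries.coeff_mul_C, frobenius_pow_apply, frobenius_pow_apply, eval_C_mul, eval_X_pow]
  exact mul_right_comm _ _ _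

theorem coeff_rhoCoeffPoly {k i : ℕ} (hi : i ≤ k) : (rhoCoeffPoly L k).coeff (2 ^ i) =
    expCoeff L i * (logSeries L).coeff (k - i) ^ 2 ^ i := by
  rw [rhoCoeffPoly, finsetSum_coeff, Finset.sum_eq_single_of_mem i (Finset.mem_range_succ_iff.2 hi)]
  · rw [coeff_C_mul, coeff_X_pow_self, mul_one]
  · intro j _ hj
    rw [coeff_C_mul_X_pow, if_neg fun h => hj (Nat.pow_right_injective le_rfl h).symm]

theorem rhoCoeffPoly_mem_linearizedPolynomials (k : ℕ) :
    rhoCoeffPoly L k ∈ linearizedPolynomials L 2 := by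
  refine sum_mem fun i _ => ?_
  rw [← smul_eq_C_mul]
  exact Submodule.smul_mem _ _ (X_pow_mem_linearizedPolynomials i)

theorem natDegree_rhoCoeffPoly_le (k : ℕ) : (rhoCoeffPoly L k).natDegree ≤ 2 ^ k := by
  refine natDegree_sum_le_of_forall_le _ _ fun i hi => (natDegree_C_mul_X_pow_le _ _).trans ?_
  exact Nat.pow_le_pow_right two_pos (Finset.mem_range_succ_iff.1 hi)

theorem coeff_one_logSeries : (logSeries L).coeff 1 = 1 := by
  have h : (expSeries L * logSeries L).coeff 1 = 0 := by
    rw [expSeries_mul_logSeries, SkewPowerSeries.coeff_one, if_neg one_ne_zero]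
  refine CharTwo.add_eq_zero.1 ?_
  simpa [SkewPowerSeries.coeff_mul, Finset.Nat.antidiagonal_succ, expSeries, expCoeff,
    coeff_zero_logSeries] using h

variable [FaithfulSMul A L]

theorem map_vanishingPoly_dvd_rhoCoeffPoly (k : ℕ) :
    (vanishingPoly k).map (algebraMap A L) ∣ rhoCoeffPoly L k := by
  rw [vanishingPoly, Polynomial.map_prod]
  simp only [Polynomial.map_sub, map_X, map_C]
  refine Finset.prod_dvd_of_coprime ?_ fun c hc => ?_
  · exact (pairwise_coprime_X_sub_C (FaithfulSMul.algebraMap_injective A L)).set_pairwise _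
  · rw [dvd_iff_isRoot, IsRoot, eval_rhoCoeffPoly, coeff_rhoSeries_of_deg_lt (mem_degLT.1 hc)]

theorem exists_rhoCoeffPoly_eq (n : ℕ) : ∃ μ : L, rhoCoeffPoly L (n + 2) =
    expCoeff L (n + 2) • (vanishingPoly (n + 2)).map (algebraMap A L) ^ 2 +
      μ • (vanishingPoly (n + 2)).map (algebraMap A L) := by
  have h_monic := monic_vanishingPoly (n + 2)
  have h_coeff : (rhoCoeffPoly L (n + 2)).coeff (2 ^ (n + 2)) = expCoeff L (n + 2) := by
    rw [coeff_rhoCoeffPoly le_rfl, Nat.sub_self, coeff_zero_logSeries, one_pow, mul_one]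
  rw [← h_coeff]
  exact exists_eq_smul_pow_char_add_smul_of_dvd (rhoCoeffPoly_mem_linearizedPolynomials _)
    (map_mem_linearizedPolynomials _ (vanishingPoly_mem_linearizedPolynomials _))
    (h_monic.map _) ((h_monic.natDegree_map _).trans (natDegree_vanishingPoly n))
    (natDegree_rhoCoeffPoly_le _) (map_vanishingPoly_dvd_rhoCoeffPoly _)

theorem exists_comparison (n : ℕ) : ∃ μ : L,
    expCoeff L (n + 2) * algebraMap A L (D (n + 2)) ^ 2 + μ * algebraMap A L (D (n + 2)) = 1 ∧
    expCoeff L (n + 1) = expCoeff L (n + 2) * algebraMap A L (sumDPow (n + 1)) ^ 2 + μ ∧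
    (logSeries L).coeff (n + 2) = μ * ∏ i ∈ Finset.Ico 2 (n + 2), algebraMap A L (D i) := by
  obtain ⟨μ, hμ⟩ := exists_rhoCoeffPoly_eq (L := L) n
  refine ⟨μ, ?_, ?_, ?_⟩
  · obtain ⟨i, j, -, ha⟩ := exists_x_pow_mul_y_pow_deg_eq (n := n + 2) (by lia)
    have h := congrArg (eval (algebraMap A L (x ^ i * y ^ j))) hμ
    rw [eval_rhoCoeffPoly, coeff_rhoSeries_of_deg_eq ha, eval_add, eval_smul, eval_smul, eval_pow,
      eval_map_algebraMap, aeval_algebraMap_apply_eq_algebraMap_eval,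
      eval_vanishingPoly_of_deg_eq ha] at h
    exact h.symm
  · have h := congrArg (coeff · (2 ^ (n + 1))) hμ
    rwa [coeff_rhoCoeffPoly (by lia), show n + 2 - (n + 1) = 1 by lia, coeff_one_logSeries, one_pow,
      mul_one, coeff_add, coeff_smul, coeff_smul, pow_succ 2 n, coeff_pow_char_mul, ← pow_succ 2,
      coeff_map, coeff_map, coeff_vanishingPoly_two_pow, coeff_vanishingPoly_two_pow_succ, map_one,
      smul_eq_mul, smul_eq_mul, mul_one] at h
  · have h := congrArg (coeff · (2 ^ 0)) hμ
    rwa [coeff_rhoCoeffPoly (Nat.zero_le _), pow_zero, pow_one, coeff_add, coeff_smul, coeff_smul,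
      coeff_one_pow_char, coeff_map, coeff_one_vanishingPoly, smul_zero, zero_add,
      smul_eq_mul, expCoeff, one_mul, map_prod, Nat.sub_zero] at h

end Comparison

/-! ### The degrees of the coefficients -/

section CoeffDegree

open Polynomial

theorem card_degLT (n : ℕ) : (degLT (n + 2)).card = 2 ^ (n + 1) := by
  rw [← natDegree_vanishingPoly, vanishingPoly, natDegree_finsetProd_X_sub_C_eq_card]

theorem deg_D (n : ℕ) : deg (D (n + 2)) = ((n + 2) * 2 ^ (n + 1) : ℕ) := by
  obtain ⟨i, j, -, hb⟩ := exists_x_pow_mul_y_pow_deg_eq (n := n + 2) (by lia)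
  have h_deg (c : A) (hc : c ∈ degLT (n + 2)) :
      deg (x ^ i * y ^ j + c) = (n + 2 : ℕ) :=
    (deg_add_eq_left ((mem_degLT.1 hc).trans_eq hb.symm)).trans hb
  rw [D, prod_deg_eq hb, deg_prod, Finset.sum_congr rfl h_deg, Finset.sum_const, card_degLT,
    nsmul_eq_mul, mul_comm, Nat.cast_mul]

theorem deg_sumDPow (n : ℕ) : deg (sumDPow (n + 2)) = ((n + 2) * 2 ^ (n + 1) : ℕ) := by
  rw [← deg_D, sumDPow_succ (by lia)]
  refine deg_add_eq_right ?_
  rw [deg_D, deg_pow]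
  cases n with
  | zero => rw [sumDPow_one, deg_one]; norm_num
  | succ n =>
    rw [deg_sumDPow n, nsmul_eq_mul]
    norm_cast
    rw [mul_left_comm, ← pow_succ']
    gcongr
    exact Nat.lt_succ_self _

end CoeffDegree

section Nonvanishing

variable {L : Type*} [Field L] [Algebra A L] [FaithfulSMul A L]

theorem expCoeff_mul_D_mul_sumDPow (n : ℕ) :
    expCoeff L (n + 2) * algebraMap A L (D (n + 2) * sumDPow (n + 2)) =
      1 + expCoeff L (n + 1) * algebraMap A L (D (n + 2)) := by
  obtain ⟨μ, h_value, h_coeff, -⟩ := exists_comparison (L := L) n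
  rw [h_coeff, ← h_value, sumDPow_succ n.succ_pos, map_mul, map_add, map_pow]
  linear_combination (-μ * algebraMap A L (D (n + 2))) * CharTwo.two_eq_zero (R := L)

theorem coeff_logSeries_mul_D (n : ℕ) :
    (logSeries L).coeff (n + 2) * algebraMap A L (D (n + 2)) =
      (1 + expCoeff L (n + 2) * algebraMap A L (D (n + 2)) ^ 2) *
        ∏ i ∈ Finset.Ico 2 (n + 2), algebraMap A L (D i) := by
  obtain ⟨μ, h_value, -, h_log⟩ := exists_comparison (L := L) n
  have h_mu : 1 + expCoeff L (n + 2) * algebraMap A L (D (n + 2)) ^ 2 =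
      μ * algebraMap A L (D (n + 2)) := by
    rw [← h_value, add_right_comm, CharTwo.add_self_eq_zero, zero_add]
  rw [h_log, h_mu]
  ring

/-- In terms of the extension of `deg` to fractions, the exponential coefficient with index `n + 1`
has degree `-n * 2 ^ (n + 1)`. -/
theorem exists_expCoeff_mul_eq (n : ℕ) : ∃ (a b : A) (i : ℕ),
    deg a = i ∧ deg b = (i + n * 2 ^ (n + 1) : ℕ) ∧
      expCoeff L (n + 1) * algebraMap A L b = algebraMap A L a := by
  induction n with
  | zero => exact ⟨1, 1, 0, deg_one, by simpa using deg_one, by simp [expCoeff]⟩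
  | succ n ih =>
    obtain ⟨a, b, i, ha, hb, h⟩ := ih
    have haD : deg (a * D (n + 2)) = (i + (n + 2) * 2 ^ (n + 1) : ℕ) := by
      rw [deg_mul, ha, deg_D, Nat.cast_add]
    refine ⟨b + a * D (n + 2), D (n + 2) * sumDPow (n + 2) * b, i + (n + 2) * 2 ^ (n + 1),
      ?_, ?_, ?_⟩
    · rw [deg_add_eq_right, haD]
      rw [haD, hb, Nat.cast_lt]
      gcongr
      lia
    · rw [deg_mul, deg_mul, deg_D, deg_sumDPow, hb]
      norm_cast
      ring
    · rw [map_mul, ← mul_assoc, expCoeff_mul_D_mul_sumDPow, map_add, map_mul, ← h]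
      ring

theorem algebraMap_ne_zero_of_deg_eq_natCast {a : A} {n : ℕ} (ha : deg a = n) :
    algebraMap A L a ≠ 0 :=
  (map_ne_zero_iff _ (FaithfulSMul.algebraMap_injective A L)).2 (ne_zero_of_deg_eq_natCast ha)

theorem expCoeff_ne_zero (n : ℕ) : expCoeff L n ≠ 0 := by
  cases n with
  | zero => exact one_ne_zero
  | succ n =>
    obtain ⟨a, b, i, ha, -, h⟩ := exists_expCoeff_mul_eq (L := L) n
    exact left_ne_zero_of_mul (h ▸ algebraMap_ne_zero_of_deg_eq_natCast ha)

theorem algebraMap_D_ne_zero (n : ℕ) : algebraMap A L (D n) ≠ 0 := by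
  simp only [D, map_prod, Finset.prod_ne_zero_iff]
  exact fun a ha => algebraMap_ne_zero_of_deg_eq_natCast ((finite_deg_eq n).mem_toFinset.1 ha)

theorem algebraMap_sumDPow_ne_zero (n : ℕ) : algebraMap A L (sumDPow (n + 2)) ≠ 0 :=
  algebraMap_ne_zero_of_deg_eq_natCast (deg_sumDPow n)

theorem one_add_expCoeff_mul_D_ne_zero (n : ℕ) :
    1 + expCoeff L (n + 1) * algebraMap A L (D (n + 2)) ≠ 0 := by
  rw [← expCoeff_mul_D_mul_sumDPow, map_mul]
  exact mul_ne_zero (expCoeff_ne_zero _)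
    (mul_ne_zero (algebraMap_D_ne_zero _) (algebraMap_sumDPow_ne_zero _))

theorem one_add_expCoeff_mul_D_sq_ne_zero (n : ℕ) :
    1 + expCoeff L (n + 2) * algebraMap A L (D (n + 2)) ^ 2 ≠ 0 := by
  obtain ⟨a, b, i, ha, hb, h⟩ := exists_expCoeff_mul_eq (L := L) (n + 1)
  have haD : deg (a * D (n + 2) ^ 2) = (i + (n + 2) * 2 ^ (n + 2) : ℕ) := by
    rw [deg_mul, deg_pow, ha, deg_D, nsmul_eq_mul]
    norm_cast
    ring
  have h_deg : deg (b + a * D (n + 2) ^ 2) = (i + (n + 2) * 2 ^ (n + 2) : ℕ) := by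
    rw [deg_add_eq_right, haD]
    rw [haD, hb, Nat.cast_lt]
    gcongr
    lia
  refine left_ne_zero_of_mul (b := algebraMap A L b) ?_
  convert algebraMap_ne_zero_of_deg_eq_natCast (L := L) h_deg using 1
  rw [map_add, map_mul, map_pow, ← h]
  ring

theorem coeff_logSeries_ne_zero (n : ℕ) : (logSeries L).coeff n ≠ 0 := by
  rcases n with - | - | n
  · exact coeff_zero_logSeries.trans_ne one_ne_zero
  · exact coeff_one_logSeries.trans_ne one_ne_zero
  · refine left_ne_zero_of_mul (b := algebraMap A L (D (n + 2))) ?_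
    rw [coeff_logSeries_mul_D]
    exact mul_ne_zero (one_add_expCoeff_mul_D_sq_ne_zero n)
      (Finset.prod_ne_zero_iff.2 fun i _ => algebraMap_D_ne_zero i)

end Nonvanishing

/-! ### The denominators -/

section Denominators

variable (L : Type*) [Field L] [Algebra A L]

/-- The denominators `d k` of the exponential of `ρ`. -/
def expDenom (k : ℕ) : L := 1 / expCoeff L k

/-- The denominators `ℓ k` of the logarithm of `ρ`. -/
def logDenom (k : ℕ) : L := 1 / (logSeries L).coeff k

variable {L}

theorem isExponential_iff_eq_linearSeries_one_div [FaithfulSMul A L] {e : PowerSeries L} :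
    IsExponential e ↔ e = linearSeries fun i => 1 / expDenom L i := by
  simpa only [expDenom, one_div_one_div] using isExponential_iff

theorem isLogarithm_iff_eq_linearSeries_one_div [FaithfulSMul A L] {e l : PowerSeries L}
    (he : IsExponential e) : IsLogarithm e l ↔ l = linearSeries fun i => 1 / logDenom L i := by
  simpa only [logDenom, one_div_one_div, isExponential_iff.1 he] using isLogarithm_iff

variable [FaithfulSMul A L]

theorem expDenom_ne_zero (k : ℕ) : expDenom L k ≠ 0 := one_div_ne_zero (expCoeff_ne_zero k)

theorem logDenom_ne_zero (k : ℕ) : logDenom L k ≠ 0 := one_div_ne_zero (coeff_logSeries_ne_zero k)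

theorem expDenom_two : expDenom L 2 = algebraMap A L (D 2) := by
  have h := expCoeff_mul_D_mul_sumDPow (L := L) 0
  have h_sum : 1 + expCoeff L 1 * algebraMap A L (D 2) = algebraMap A L (sumDPow 2) := by
    rw [sumDPow_succ le_rfl, sumDPow_one, expCoeff, one_mul, one_pow, map_add, map_one]
  rw [h_sum, map_mul, ← mul_assoc, mul_eq_right₀ (algebraMap_sumDPow_ne_zero 0)] at h
  exact (eq_one_div_of_mul_eq_one_right h).symm

theorem expDenom_add_D_ne_zero (n : ℕ) : expDenom L (n + 1) + algebraMap A L (D (n + 2)) ≠ 0 := by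
  refine right_ne_zero_of_mul (a := expCoeff L (n + 1)) ?_
  rw [mul_add, expDenom, mul_one_div_cancel (expCoeff_ne_zero _)]
  exact one_add_expCoeff_mul_D_ne_zero n

theorem expDenom_eq (n : ℕ) : expDenom L (n + 2) =
    algebraMap A L (D (n + 2)) * expDenom L (n + 1) /
      (expDenom L (n + 1) + algebraMap A L (D (n + 2))) * algebraMap A L (sumDPow (n + 2)) := by
  have h := expCoeff_mul_D_mul_sumDPow (L := L) n
  have h_ne := expDenom_add_D_ne_zero (L := L) n
  have h_e := expCoeff_ne_zero (L := L) (n + 1)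
  have h_e' := expCoeff_ne_zero (L := L) (n + 2)
  rw [map_mul] at h
  rw [div_mul_eq_mul_div, eq_div_iff h_ne, expDenom, expDenom]
  field_simp
  linear_combination -h

theorem expDenom_add_D_sq_mul_prod_ne_zero (n : ℕ) :
    (expDenom L (n + 2) + algebraMap A L (D (n + 2)) ^ 2) *
      ∏ i ∈ Finset.Ico 2 (n + 2), algebraMap A L (D i) ≠ 0 := by
  refine mul_ne_zero (right_ne_zero_of_mul (a := expCoeff L (n + 2)) ?_)
    (Finset.prod_ne_zero_iff.2 fun i _ => algebraMap_D_ne_zero i)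
  rw [mul_add, expDenom, mul_one_div_cancel (expCoeff_ne_zero _)]
  exact one_add_expCoeff_mul_D_sq_ne_zero n

theorem logDenom_eq (n : ℕ) : logDenom L (n + 2) =
    algebraMap A L (D (n + 2)) * expDenom L (n + 2) /
      ((expDenom L (n + 2) + algebraMap A L (D (n + 2)) ^ 2) *
        ∏ i ∈ Finset.Ico 2 (n + 2), algebraMap A L (D i)) := by
  have h := coeff_logSeries_mul_D (L := L) n
  have h_log := coeff_logSeries_ne_zero (L := L) (n + 2)
  have h_exp := expCoeff_ne_zero (L := L) (n + 2)
  rw [eq_div_iff (expDenom_add_D_sq_mul_prod_ne_zero n), logDenom, expDenom]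
  field_simp
  linear_combination -h

end Denominators

end DrinfeldExample
end

theorem mainTheorem1 {L : Type*} [Field L] [Algebra DrinfeldExample.A L]
    (hL : Function.Injective (algebraMap DrinfeldExample.A L))
    (D : ℕ → L) (hD : ∀ k, D k = algebraMap DrinfeldExample.A L (DrinfeldExample.D k)) :
    ∃ d ℓ : ℕ → L,
      (∀ k, d k ≠ 0) ∧ (∀ k, ℓ k ≠ 0) ∧
      (∀ e : PowerSeries L,
        DrinfeldExample.IsExponential e ↔
          e = DrinfeldExample.linearSeries fun i => 1 / d i) ∧
      (∀ e l : PowerSeries L, DrinfeldExample.IsExponential e →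
        (DrinfeldExample.IsLogarithm e l ↔
          l = DrinfeldExample.linearSeries fun i => 1 / ℓ i)) ∧
      d 2 = D 2 ∧
      (∀ k, 2 ≤ k → d (k - 1) + D k ≠ 0 ∧
        d k = D k * d (k - 1) / (d (k - 1) + D k) *
          (1 + ∑ i ∈ Finset.Icc 2 k, D i ^ 2 ^ (k - i))) ∧
      (∀ k, 2 ≤ k → (d k + D k ^ 2) * ∏ i ∈ Finset.Ico 2 k, D i ≠ 0 ∧
        ℓ k = D k * d k / ((d k + D k ^ 2) * ∏ i ∈ Finset.Ico 2 k, D i)) := by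
  open DrinfeldExample in
  obtain rfl : D = fun k => algebraMap A L (DrinfeldExample.D k) := funext hD
  have : FaithfulSMul A L := (faithfulSMul_iff_algebraMap_injective A L).2 hL
  refine ⟨expDenom L, logDenom L, expDenom_ne_zero, logDenom_ne_zero, fun e =>
    isExponential_iff_eq_linearSeries_one_div, fun e l =>
    isLogarithm_iff_eq_linearSeries_one_div, expDenom_two, fun k hk => ?_, fun k hk => ?_⟩
  · obtain ⟨n, rfl⟩ := Nat.exists_eq_add_of_le' hk
    exact ⟨expDenom_add_D_ne_zero n, algebraMap_sumDPow (L := L) (n + 2) ▸ expDenom_eq n⟩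
  · obtain ⟨n, rfl⟩ := Nat.exists_eq_add_of_le' hk
    exact ⟨expDenom_add_D_sq_mul_prod_ne_zero n, logDenom_eq n⟩
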